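/- \textbf{Lemma.} Let $r,s\ge 3$ be odd integers and $\ell\ge 1$ an integer. Let $D_{r,s,\ell}$ be the dumbbell graph, obtained from vertex disjoint cycles $C_r$ and $C_s$ by choosing one vertex on each and joining them by a path of length $\ell$. A complex unit gain graph $\Phi$ on $D_{r,s,\ell}$ is an assignment of a complex number $\varphi(u,v)$ of modulus $1$ to each oriented edge such that $\varphi(v,u)=\varphi(u,v)^{-1}$. Its Hermitian adjacency matrix has the entry $\varphi(u,v)$ if $u\sim v$ and $0$ otherwise, and its energy $E(\Phi)$ is the sum of the absolute values of the eigenvalues of this matrix, counted with multiplicity. Let $\gamma_r,\gamma_s$ be the gains of the cycles $C_r,C_s$ (the products of the gains of the edges along the cycle, in either direction), and put \[ \alpha=(-1)^{(r+1)/2}\operatorname{Re}\gamma_r,\qquad \beta=(-1)^{(s+1)/2}\operatorname{Re}\gamma_s . \] Define polynomials in $u$ by $f_{-1}=0$, $f_0=1$, $f_j=f_{j-1}+u f_{j-2}$ and $g_j=f_j+u f_{j-2}$ for $j\ge 1$, and let \[ T=f_{\ell-1},\qquad R=f_{\ell-1}g_s+u f_{\ell-2}f_{s-1},\qquad S=f_{\ell-1}g_r+u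 f_{\ell-2}f_{r-1}, \] \[ M=\begin{cases} g_rg_s+u f_{r-1}f_{s-1}, & \ell=1,\\ f_{\ell-1}g_rg_s+u f_{\ell-2}\left(f_{r-1}g_s+f_{s-1}g_r\right)+u^2 f_{\ell-3}f_{r-1}f_{s-1}, & \ell\ge 2.\end{cases} \] For $t>0$ put $Z(t)=M(t^2)$, $W(t)=4t^{r+s}T(t^2)$, $X(t)=2t^rR(t^2)$, $Y(t)=2t^sS(t^2)$ and \[ K(t;\alpha,\beta)=\left(Z(t)-\alpha\beta W(t)\right)^2+\left(\alpha X(t)+\beta Y(t)\right)^2 . \] Then: (1) for every complex unit gain graph $\Phi$ on $D_{r,s,\ell}$, with $\alpha,\beta$ as above, $K(t;\alpha,\beta)>0$ for all $t>0$, the function $t\mapsto t^{-2}\log K(t;\alpha,\beta)$ is integrable on $(0,\infty)$, and \[ E(\Phi)=\frac1\pi\int_0^\infty \frac{1}{t^2}\log K(t;\alpha,\beta)\,dt ; \] (2) $R(u)S(u)-M(u)T(u)=(-1)^\ell u^\ell f_{r-1}(u)f_{s-1}(u)$ as polynomials in $u$; (3) $\operatorname{sgn}\left(X(t)Y(t)-Z(t)W(t)\right)=(-1)^\ell$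 for all $t>0$. -/

import Mathlib

open scoped Polynomial

namespace GainDumbbell

/-- A complex unit gain graph on the simple graph `G`: every oriented edge carries a complex
number of modulus one, and reversing an oriented edge inverts its gain. -/
structure UnitGain {V : Type*} (G : SimpleGraph V) where
  gain : G.Dart → Circle
  gain_symm : ∀ d : G.Dart, gain d.symm = (gain d)⁻¹

namespace UnitGain

variable {V : Type*} {G : SimpleGraph V}

open Classical in
/-- The Hermitian adjacency matrix: the gain of `(u, v)` if `u` and `v` are adjacent,
and `0` otherwise. -/
noncomputable def adjMatrix (Φ : UnitGain G) : Matrix V V ℂ :=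
  fun u v => if h : G.Adj u v then (Φ.gain ⟨(u, v), h⟩ : ℂ) else 0

theorem adjMatrix_isHermitian (Φ : UnitGain G) : Φ.adjMatrix.IsHermitian := by
  ext u v
  rw [Matrix.conjTranspose_apply]
  unfold adjMatrix
  by_cases h : G.Adj u v
  · have h' : G.Adj v u := h.symm
    have key := Φ.gain_symm ⟨(u, v), h⟩
    have e : (SimpleGraph.Dart.symm ⟨(u, v), h⟩ : G.Dart) = ⟨(v, u), h'⟩ := rfl
    rw [e] at key
    rw [dif_pos h', dif_pos h, key, Circle.coe_inv_eq_conj]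
    simp
  · have h' : ¬ G.Adj v u := fun k => h k.symm
    rw [dif_neg h', dif_neg h]
    simp

/-- The energy: the sum of the absolute values of the eigenvalues (with multiplicity) of the
Hermitian adjacency matrix. -/
noncomputable def energy [Fintype V] [DecidableEq V] (Φ : UnitGain G) : ℝ :=
  ∑ j, |Φ.adjMatrix_isHermitian.eigenvalues j|

/-- The gain of the closed walk `c 0, c 1, …, c (m - 1), c 0`: the product of the gains of its
oriented edges (`finRotate m` sends `i` to `i + 1` modulo `m`). -/
noncomputable def cycleGain (Φ : UnitGain G) {m : ℕ} (c : Fin m → V)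
    (hc : ∀ i, G.Adj (c i) (c (finRotate m i))) : Circle :=
  ∏ i, Φ.gain ⟨(c i, c (finRotate m i)), hc i⟩

end UnitGain

/-- Vertices of the dumbbell graph: those of the first cycle, those of the second cycle, and the
`ℓ - 1` interior vertices of the connecting path. -/
abbrev Vertex (r s ℓ : ℕ) : Type := Fin r ⊕ Fin s ⊕ Fin (ℓ - 1)

/-- Adjacency in the dumbbell graph. The path of length `ℓ` joins vertex `0` of the first cycle
to vertex `0` of the second one; it is a single edge if `ℓ = 1`. -/
def DumbbellAdj (r s ℓ : ℕ) : Vertex r s ℓ → Vertex r s ℓ → Prop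
  | .inl i, .inl j => (SimpleGraph.cycleGraph r).Adj i j
  | .inr (.inl i), .inr (.inl j) => (SimpleGraph.cycleGraph s).Adj i j
  | .inr (.inr p), .inr (.inr q) => (SimpleGraph.pathGraph (ℓ - 1)).Adj p q
  | .inl i, .inr (.inl j) => ℓ = 1 ∧ i.val = 0 ∧ j.val = 0
  | .inr (.inl j), .inl i => ℓ = 1 ∧ i.val = 0 ∧ j.val = 0
  | .inl i, .inr (.inr p) => i.val = 0 ∧ p.val = 0
  | .inr (.inr p), .inl i => i.val = 0 ∧ p.val = 0
  | .inr (.inl j), .inr (.inr p) => j.val = 0 ∧ p.val + 2 = ℓ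
  | .inr (.inr p), .inr (.inl j) => j.val = 0 ∧ p.val + 2 = ℓ

/-- The dumbbell graph `D_{r,s,ℓ}` (for `r, s ≥ 3` and `ℓ ≥ 1`). -/
def dumbbell (r s ℓ : ℕ) : SimpleGraph (Vertex r s ℓ) where
  Adj := DumbbellAdj r s ℓ
  symm := ⟨by
    rintro (i | i | i) (j | j | j) h
    · exact SimpleGraph.Adj.symm (G := SimpleGraph.cycleGraph r) h
    · exact h
    · exact h
    · exact h
    · exact SimpleGraph.Adj.symm (G := SimpleGraph.cycleGraph s) h
    · exact h
    · exact h
    · exact h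
    · exact SimpleGraph.Adj.symm (G := SimpleGraph.pathGraph (ℓ - 1)) h⟩
  loopless := ⟨by
    rintro (i | i | i) h
    · exact SimpleGraph.irrefl (SimpleGraph.cycleGraph r) h
    · exact SimpleGraph.irrefl (SimpleGraph.cycleGraph s) h
    · exact SimpleGraph.irrefl (SimpleGraph.pathGraph (ℓ - 1)) h⟩

theorem cycleGraph_adj_finRotate {m : ℕ} (hm : 3 ≤ m) (i : Fin m) :
    (SimpleGraph.cycleGraph m).Adj i (finRotate m i) := by
  obtain ⟨k, rfl⟩ : ∃ k, m = k + 2 := ⟨m - 2, by omega⟩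
  rw [SimpleGraph.cycleGraph_adj, finRotate_apply]
  right
  simp

theorem dumbbell_adj_left {r : ℕ} (hr : 3 ≤ r) (s ℓ : ℕ) (i : Fin r) :
    (dumbbell r s ℓ).Adj (.inl i) (.inl (finRotate r i)) :=
  cycleGraph_adj_finRotate hr i

theorem dumbbell_adj_right (r : ℕ) {s : ℕ} (hs : 3 ≤ s) (ℓ : ℕ) (i : Fin s) :
    (dumbbell r s ℓ).Adj (.inr (.inl i)) (.inr (.inl (finRotate s i))) :=
  cycleGraph_adj_finRotate hs i

/-- The gain of the cycle `C_r` of a gain graph on `D_{r,s,ℓ}`. -/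
noncomputable def gainLeft {r s ℓ : ℕ} (hr : 3 ≤ r) (Φ : UnitGain (dumbbell r s ℓ)) : Circle :=
  Φ.cycleGain (fun i : Fin r => .inl i) (dumbbell_adj_left hr s ℓ)

/-- The gain of the cycle `C_s` of a gain graph on `D_{r,s,ℓ}`. -/
noncomputable def gainRight {r s ℓ : ℕ} (hs : 3 ≤ s) (Φ : UnitGain (dumbbell r s ℓ)) : Circle :=
  Φ.cycleGain (fun i : Fin s => .inr (.inl i)) (dumbbell_adj_right r hs ℓ)

/-- The sign `δ_r = (-1)^((r+1)/2)`, for odd `r`. -/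
def delta (r : ℕ) : ℝ := (-1) ^ ((r + 1) / 2)

/-- `α = δ_r Re(γ_r)`. -/
noncomputable def alpha {r s ℓ : ℕ} (hr : 3 ≤ r) (Φ : UnitGain (dumbbell r s ℓ)) : ℝ :=
  delta r * (gainLeft hr Φ : ℂ).re

/-- `β = δ_s Re(γ_s)`. -/
noncomputable def beta {r s ℓ : ℕ} (hs : 3 ≤ s) (Φ : UnitGain (dumbbell r s ℓ)) : ℝ :=
  delta s * (gainRight hs Φ : ℂ).re

/-- The polynomials `f_j` with the index shifted by one: `fAux k = f_{k-1}`. -/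
noncomputable def fAux : ℕ → ℝ[X]
  | 0 => 0
  | 1 => 1
  | k + 2 => fAux (k + 1) + Polynomial.X * fAux k

/-- The polynomials `f_j`, `j ≥ -1`, with `f_{-1} = 0`, `f_0 = 1` and
`f_j = f_{j-1} + u f_{j-2}` for `j ≥ 1` (indices below `-1` are never used). -/
noncomputable def f (j : ℤ) : ℝ[X] := fAux (j + 1).toNat

theorem f_neg_one : f (-1) = 0 := rfl

theorem f_zero : f 0 = 1 := rfl

theorem f_rec (j : ℤ) (hj : 1 ≤ j) : f j = f (j - 1) + Polynomial.X * f (j - 2) := by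
  obtain ⟨k, rfl⟩ : ∃ k : ℕ, j = k + 1 := ⟨(j - 1).toNat, by omega⟩
  have h0 : ((k : ℤ) + 1 + 1).toNat = k + 2 := by omega
  have h1 : ((k : ℤ) + 1 - 1 + 1).toNat = k + 1 := by omega
  have h2 : ((k : ℤ) + 1 - 2 + 1).toNat = k := by omega
  simp only [f, h0, h1, h2, fAux]

/-- The polynomials `g_j = f_j + u f_{j-2}`, `j ≥ 1`. -/
noncomputable def g (j : ℤ) : ℝ[X] := f j + Polynomial.X * f (j - 2)

noncomputable def polyT (ℓ : ℕ) : ℝ[X] := f (ℓ - 1)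

noncomputable def polyR (s ℓ : ℕ) : ℝ[X] :=
  f (ℓ - 1) * g s + Polynomial.X * f (ℓ - 2) * f (s - 1)

noncomputable def polyS (r ℓ : ℕ) : ℝ[X] :=
  f (ℓ - 1) * g r + Polynomial.X * f (ℓ - 2) * f (r - 1)

noncomputable def polyM (r s ℓ : ℕ) : ℝ[X] :=
  if ℓ = 1 then
    g r * g s + Polynomial.X * f (r - 1) * f (s - 1)
  else
    f (ℓ - 1) * g r * g s
      + Polynomial.X * f (ℓ - 2) * (f (r - 1) * g s + f (s - 1) * g r)
      + Polynomial.X ^ 2 * f (ℓ - 3) * f (r - 1) * f (s - 1)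

noncomputable def kerZ (r s ℓ : ℕ) (t : ℝ) : ℝ := (polyM r s ℓ).eval (t ^ 2)

noncomputable def kerW (r s ℓ : ℕ) (t : ℝ) : ℝ := 4 * t ^ (r + s) * (polyT ℓ).eval (t ^ 2)

noncomputable def kerX (r s ℓ : ℕ) (t : ℝ) : ℝ := 2 * t ^ r * (polyR s ℓ).eval (t ^ 2)

noncomputable def kerY (r s ℓ : ℕ) (t : ℝ) : ℝ := 2 * t ^ s * (polyS r ℓ).eval (t ^ 2)

/-- The kernel `K(t; α, β) = (Z - αβW)² + (αX + βY)²`. -/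
noncomputable def kernelK (r s ℓ : ℕ) (a b t : ℝ) : ℝ :=
  (kerZ r s ℓ t - a * b * kerW r s ℓ t) ^ 2 + (a * kerX r s ℓ t + b * kerY r s ℓ t) ^ 2

end GainDumbbell

/-!
If `A` is a Hermitian matrix with eigenvalues `λ_j`, then `|det (1 + itA)|² = ∏ (1 + t² λ_j²)`, so
the scaled integrals `∫₀^∞ t⁻² log (1 + t² λ²) dt = π |λ|` express the energy through
`|det (1 + itA)|²`. For a dumbbell this determinant is computed by deleting bridges, a bridge `vw`
contributing `u` times the product of the minors at `v` and `w` with `u = t²`. Paths give the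
polynomials `f_j`; an `m`-cycle gives `g_m` plus a term from its two cyclic orientations, which for
odd `m` is the purely imaginary number `-2i (-1)^((m+1)/2) Re γ t^m`. Hence `K` is the sum of the
squares of the real and imaginary parts of the determinant. The identity for `RS - MT` reduces to
the Cassini identity `f_n² - f_{n+1} f_{n-1} = (-u)^n`.
-/

namespace GainDumbbell

section CoulsonIntegral

open Filter Topology MeasureTheory

theorem tendsto_log_one_add_sq_div_atTop :
    Tendsto (fun t : ℝ => Real.log (1 + t ^ 2) / t) atTop (𝓝 0) := by
  have h_two_mul : Tendsto (fun t : ℝ => 2 * t) atTop atTop :=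
    tendsto_id.const_mul_atTop two_pos
  have h_upper : Tendsto (fun t : ℝ => 4 * (Real.log (2 * t) / (2 * t))) atTop (𝓝 0) := by
    simpa using (Real.isLittleO_log_id_atTop.tendsto_div_nhds_zero.comp h_two_mul).const_mul 4
  refine tendsto_of_tendsto_of_tendsto_of_le_of_le' tendsto_const_nhds h_upper ?_ ?_
  · filter_upwards [eventually_ge_atTop 0] with t ht
    exact div_nonneg (Real.log_nonneg (by nlinarith)) ht
  · filter_upwards [eventually_ge_atTop 1] with t ht
    have h_log : Real.log (1 + t ^ 2) ≤ 2 * Real.log (2 * t) := by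
      rw [show 2 * Real.log (2 * t) = Real.log ((2 * t) ^ 2) by simp [Real.log_pow]]
      exact Real.log_le_log (by positivity) (by nlinarith)
    calc Real.log (1 + t ^ 2) / t ≤ 2 * Real.log (2 * t) / t := by gcongr
      _ = 4 * (Real.log (2 * t) / (2 * t)) := by field_simp; ring

theorem abs_log_one_add_sq_div_le (t : ℝ) : |Real.log (1 + t ^ 2) / t| ≤ |t| := by
  rcases eq_or_ne t 0 with rfl | ht
  · simp
  · have h_nonneg : 0 ≤ Real.log (1 + t ^ 2) := Real.log_nonneg (by nlinarith [sq_nonneg t])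
    have h_le := Real.log_le_sub_one_of_pos (show 0 < 1 + t ^ 2 by positivity)
    rw [abs_div, abs_of_nonneg h_nonneg, div_le_iff₀ (abs_pos.2 ht), abs_mul_abs_self]
    linarith

theorem continuousAt_log_one_add_sq_div_zero :
    ContinuousAt (fun t : ℝ => Real.log (1 + t ^ 2) / t) 0 := by
  rw [ContinuousAt, div_zero]
  exact squeeze_zero_norm abs_log_one_add_sq_div_le (by simpa using continuous_abs.tendsto (0 : ℝ))

theorem hasDerivAt_two_mul_arctan_sub_log_div {t : ℝ} (ht : t ≠ 0) :
    HasDerivAt (fun t : ℝ => 2 * Real.arctan t - Real.log (1 + t ^ 2) / t)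
      (1 / t ^ 2 * Real.log (1 + t ^ 2)) t := by
  have h_pos : 1 + t ^ 2 ≠ 0 := by positivity
  have h_log := ((hasDerivAt_pow 2 t).const_add 1).log h_pos
  refine (((Real.hasDerivAt_arctan t).const_mul 2).sub
    (h_log.div (hasDerivAt_id t) ht)).congr_deriv ?_
  simp only [id]
  field_simp
  ring

theorem continuousWithinAt_two_mul_arctan_sub_log_div :
    ContinuousWithinAt (fun t : ℝ => 2 * Real.arctan t - Real.log (1 + t ^ 2) / t)
      (Set.Ici 0) 0 :=
  ((Real.continuous_arctan.continuousAt.const_mul 2).sub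
    continuousAt_log_one_add_sq_div_zero).continuousWithinAt

theorem tendsto_two_mul_arctan_sub_log_div :
    Tendsto (fun t : ℝ => 2 * Real.arctan t - Real.log (1 + t ^ 2) / t) atTop (𝓝 Real.pi) := by
  have h := ((Real.tendsto_arctan_atTop.mono_right nhdsWithin_le_nhds).const_mul 2).sub
    tendsto_log_one_add_sq_div_atTop
  rwa [sub_zero, mul_div_cancel₀ _ two_ne_zero] at h

theorem log_one_add_sq_div_sq_nonneg (t : ℝ) : 0 ≤ 1 / t ^ 2 * Real.log (1 + t ^ 2) :=
  mul_nonneg (by positivity) (Real.log_nonneg (by nlinarith [sq_nonneg t]))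

theorem integrableOn_log_one_add_sq_div_sq :
    IntegrableOn (fun t : ℝ => 1 / t ^ 2 * Real.log (1 + t ^ 2)) (Set.Ioi 0) :=
  integrableOn_Ioi_deriv_of_nonneg continuousWithinAt_two_mul_arctan_sub_log_div
    (fun _ ht => hasDerivAt_two_mul_arctan_sub_log_div (ne_of_gt ht))
    (fun t _ => log_one_add_sq_div_sq_nonneg t) tendsto_two_mul_arctan_sub_log_div

theorem integral_log_one_add_sq_div_sq :
    ∫ t in Set.Ioi (0 : ℝ), 1 / t ^ 2 * Real.log (1 + t ^ 2) = Real.pi := by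
  rw [integral_Ioi_of_hasDerivAt_of_nonneg continuousWithinAt_two_mul_arctan_sub_log_div
    (fun _ ht => hasDerivAt_two_mul_arctan_sub_log_div (ne_of_gt ht))
    (fun t _ => log_one_add_sq_div_sq_nonneg t) tendsto_two_mul_arctan_sub_log_div]
  simp

theorem log_one_add_sq_mul_sq_div_sq (c t : ℝ) :
    1 / t ^ 2 * Real.log (1 + t ^ 2 * c ^ 2)
      = c ^ 2 * (1 / (|c| * t) ^ 2 * Real.log (1 + (|c| * t) ^ 2)) := by
  rcases eq_or_ne c 0 with rfl | hc
  · simp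
  · rw [mul_pow, sq_abs, mul_comm (c ^ 2) (t ^ 2)]
    field_simp

theorem integrableOn_log_one_add_sq_mul_sq_div_sq (c : ℝ) :
    IntegrableOn (fun t : ℝ => 1 / t ^ 2 * Real.log (1 + t ^ 2 * c ^ 2)) (Set.Ioi 0) := by
  rcases eq_or_ne c 0 with rfl | hc
  · simp
  · simp only [log_one_add_sq_mul_sq_div_sq c]
    refine Integrable.const_mul ?_ _
    rw [← IntegrableOn, integrableOn_Ioi_comp_mul_left_iff
      (fun t => 1 / t ^ 2 * Real.log (1 + t ^ 2)) 0 (abs_pos.2 hc), mul_zero]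
    exact integrableOn_log_one_add_sq_div_sq

theorem integral_log_one_add_sq_mul_sq_div_sq (c : ℝ) :
    ∫ t in Set.Ioi (0 : ℝ), 1 / t ^ 2 * Real.log (1 + t ^ 2 * c ^ 2) = Real.pi * |c| := by
  rcases eq_or_ne c 0 with rfl | hc
  · simp
  · simp only [log_one_add_sq_mul_sq_div_sq c]
    rw [integral_const_mul, integral_comp_mul_left_Ioi
      (fun t => 1 / t ^ 2 * Real.log (1 + t ^ 2)) 0 (abs_pos.2 hc), mul_zero,
      integral_log_one_add_sq_div_sq, smul_eq_mul, ← sq_abs]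
    field_simp [abs_ne_zero.2 hc]

end CoulsonIntegral

section HermitianDeterminant

open MeasureTheory

variable {V : Type*} [Fintype V] [DecidableEq V]

theorem det_one_add_smul_of_isHermitian {𝕜 : Type*} [RCLike 𝕜] {A : Matrix V V 𝕜}
    (hA : A.IsHermitian) (z : 𝕜) :
    (1 + z • A).det = ∏ j, (1 + z * (hA.eigenvalues j : 𝕜)) := by
  have h_diag : 1 + z • A = Unitary.conjStarAlgAut 𝕜 _ hA.eigenvectorUnitary
      (Matrix.diagonal fun j => 1 + z * (hA.eigenvalues j : 𝕜)) := by
    conv_lhs => rw [hA.spectral_theorem]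
    rw [← map_one (Unitary.conjStarAlgAut 𝕜 _ hA.eigenvectorUnitary), ← map_smul, ← map_add,
      ← Matrix.diagonal_one, ← Matrix.diagonal_smul, Matrix.diagonal_add]
    rfl
  rw [h_diag, Unitary.conjStarAlgAut_apply, Matrix.det_mul_comm, ← mul_assoc,
    Unitary.coe_star_mul_self, one_mul, Matrix.det_diagonal]

variable {A : Matrix V V ℂ}

theorem normSq_det_one_add_I_mul_smul (hA : A.IsHermitian) (t : ℝ) :
    Complex.normSq (1 + (Complex.I * t) • A).det = ∏ j, (1 + t ^ 2 * hA.eigenvalues j ^ 2) := by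
  rw [det_one_add_smul_of_isHermitian hA, map_prod]
  refine Finset.prod_congr rfl fun j _ => ?_
  have h_re_im : 1 + Complex.I * t * (hA.eigenvalues j : ℂ)
      = ((1 : ℝ) : ℂ) + ((t * hA.eigenvalues j : ℝ) : ℂ) * Complex.I := by
    push_cast
    ring
  refine (congrArg Complex.normSq h_re_im).trans ?_
  rw [Complex.normSq_add_mul_I]
  ring

theorem normSq_det_one_add_I_mul_smul_pos (hA : A.IsHermitian) (t : ℝ) :
    0 < Complex.normSq (1 + (Complex.I * t) • A).det := by
  rw [normSq_det_one_add_I_mul_smul hA]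
  exact Finset.prod_pos fun j _ => by positivity

theorem log_normSq_det_one_add_I_mul_smul (hA : A.IsHermitian) (t : ℝ) :
    1 / t ^ 2 * Real.log (Complex.normSq (1 + (Complex.I * t) • A).det)
      = ∑ j, 1 / t ^ 2 * Real.log (1 + t ^ 2 * hA.eigenvalues j ^ 2) := by
  rw [normSq_det_one_add_I_mul_smul hA, Real.log_prod fun j _ => by positivity, Finset.mul_sum]

theorem integrableOn_log_normSq_det (hA : A.IsHermitian) :
    IntegrableOn (fun t : ℝ => 1 / t ^ 2 *
      Real.log (Complex.normSq (1 + (Complex.I * t) • A).det)) (Set.Ioi 0) := by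
  simp only [log_normSq_det_one_add_I_mul_smul hA]
  exact integrable_finsetSum _ fun j _ => integrableOn_log_one_add_sq_mul_sq_div_sq _

theorem sum_abs_eigenvalues_eq_integral (hA : A.IsHermitian) :
    ∑ j, |hA.eigenvalues j| = 1 / Real.pi * ∫ t in Set.Ioi (0 : ℝ),
      1 / t ^ 2 * Real.log (Complex.normSq (1 + (Complex.I * t) • A).det) := by
  simp only [log_normSq_det_one_add_I_mul_smul hA]
  rw [integral_finsetSum _ fun j _ => integrableOn_log_one_add_sq_mul_sq_div_sq _]
  simp only [integral_log_one_add_sq_mul_sq_div_sq, ← Finset.mul_sum]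
  rw [← mul_assoc, one_div_mul_cancel Real.pi_ne_zero, one_mul]

end HermitianDeterminant

open Matrix Polynomial

section Determinant

variable {R : Type*} [CommRing R] {m n : Type*} [Fintype m] [Fintype n] [DecidableEq m]
  [DecidableEq n]

theorem det_add_single (A : Matrix m m R) (i j : m) (x : R) :
    (A + single i j x).det = A.det + x * A.adjugate j i := by
  have h_row : A + single i j x = A.updateRow i (A i + x • Pi.single j 1) := by
    ext k l
    rcases eq_or_ne k i with rfl | hk
    · rcases eq_or_ne l j with rfl | hl
      · simp
      · simp [hl, hl.symm]
    · simp [hk, hk.symm]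
  rw [h_row, det_updateRow_add, det_updateRow_smul, updateRow_eq_self, adjugate_apply]

theorem adjugate_fromBlocks_single_zero (A : Matrix m m R) (D : Matrix n n R) (i : m) (j : n)
    (a : R) :
    (fromBlocks A (single i j a) 0 D).adjugate (.inl i) (.inr j)
      = -(a * A.adjugate i i * D.adjugate j j) := by
  have h_swap : ((fromBlocks A (single i j a) 0 D).updateRow (.inr j)
      (Pi.single (.inl i) 1)).submatrix (Equiv.swap (.inl i) (.inr j)) id
      = fromBlocks (A.updateRow i (Pi.single i 1)) 0 (updateRow 0 j (A i))
        (D.updateRow j (a • Pi.single j 1)) := by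
    ext (k | k) (l | l)
    · rcases eq_or_ne k i with rfl | hk
      · simp [Pi.single_apply]
      · simp [Equiv.swap_apply_of_ne_of_ne, hk]
    · rcases eq_or_ne k i with rfl | hk
      · simp
      · simp [Equiv.swap_apply_of_ne_of_ne, hk, hk.symm]
    · rcases eq_or_ne k j with rfl | hk
      · simp
      · simp [Equiv.swap_apply_of_ne_of_ne, hk]
    · rcases eq_or_ne k j with rfl | hk
      · simp [single_apply, Pi.single_apply, eq_comm]
      · simp [Equiv.swap_apply_of_ne_of_ne, hk]
  have h_minor := det_permute (Equiv.swap (Sum.inl i) (Sum.inr j))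
    ((fromBlocks A (single i j a) 0 D).updateRow (.inr j) (Pi.single (.inl i) 1))
  rw [h_swap, det_fromBlocks_zero₁₂, det_updateRow_smul, ← adjugate_apply, ← adjugate_apply,
    ← adjugate_apply, Equiv.Perm.sign_swap Sum.inl_ne_inr] at h_minor
  push_cast at h_minor
  linear_combination h_minor

theorem det_fromBlocks_single_single (A : Matrix m m R) (D : Matrix n n R) (i : m) (j : n)
    (a d : R) :
    (fromBlocks A (single i j a) (single j i d) D).det
      = A.det * D.det - a * d * A.adjugate i i * D.adjugate j j := by
  have h_corner : fromBlocks A (single i j a) (single j i d) D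
      = fromBlocks A (single i j a) 0 D + single (.inr j) (.inl i) d := by
    ext (k | k) (l | l) <;> simp [single_apply]
  rw [h_corner, det_add_single, det_fromBlocks_zero₂₁, adjugate_fromBlocks_single_zero]
  ring

theorem adjugate_self_eq_det_submatrix (A : Matrix m m R) (p : m) {c : n → m}
    (hc : Function.Injective c) (hp : Set.range c = {p}ᶜ) :
    A.adjugate p p = (A.submatrix c c).det := by
  have hcp : ∀ k, c k ≠ p := fun k => by simpa using hp.le (Set.mem_range_self k)
  obtain ⟨e, he_inl, he_inr⟩ : ∃ e : Unit ⊕ n ≃ m, (∀ k, e (.inl k) = p) ∧ ∀ k, e (.inr k) = c k :=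
    ⟨Equiv.ofBijective (Sum.elim (fun _ => p) c)
      ⟨(Function.injective_of_subsingleton _).sumElim hc fun _ k => (hcp k).symm, fun q => by
        rcases eq_or_ne q p with rfl | hq
        · exact ⟨.inl (), rfl⟩
        · obtain ⟨k, rfl⟩ := hp.ge hq
          exact ⟨.inr k, rfl⟩⟩, fun _ => rfl, fun _ => rfl⟩
  have h_blocks : (A.updateRow p (Pi.single p 1)).submatrix e e
      = fromBlocks 1 0 (of fun k _ => A (c k) p) (A.submatrix c c) := by
    ext (k | k) (l | l) <;> simp [he_inl, he_inr, hcp]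
  rw [adjugate_apply, ← det_submatrix_equiv_self e, h_blocks, det_fromBlocks_zero₁₂, det_one,
    one_mul]

theorem adjugate_zero_last_of_upper_eq_zero {n : ℕ} {A : Matrix (Fin (n + 1)) (Fin (n + 1)) R}
    (hA : ∀ i j : Fin (n + 1), i.val + 1 < j.val → A i j = 0) :
    A.adjugate 0 (Fin.last n) = (-1) ^ n * ∏ i : Fin n, A i.castSucc i.succ := by
  rw [adjugate_fin_succ_eq_det_submatrix, Fin.succAbove_last, Fin.succAbove_zero,
    det_of_isLowerTriangular]
  · simp
  · intro i j hij
    have h_lt : i.val < j.val := hij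
    refine hA _ _ ?_
    simpa only [Fin.val_castSucc, Fin.val_succ, add_lt_add_iff_right] using h_lt

theorem adjugate_last_zero_of_lower_eq_zero {n : ℕ} {A : Matrix (Fin (n + 1)) (Fin (n + 1)) R}
    (hA : ∀ i j : Fin (n + 1), j.val + 1 < i.val → A i j = 0) :
    A.adjugate (Fin.last n) 0 = (-1) ^ n * ∏ i : Fin n, A i.succ i.castSucc := by
  have h := adjugate_zero_last_of_upper_eq_zero (A := Aᵀ) fun i j hij => hA j i hij
  rwa [← adjugate_transpose] at h

theorem det_add_single_add_single {n : ℕ} (A : Matrix (Fin (n + 2)) (Fin (n + 2)) R) (a b : R) :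
    (A + single 0 (Fin.last _) a + single (Fin.last _) 0 b).det
      = A.det + a * A.adjugate (Fin.last _) 0 + b * A.adjugate 0 (Fin.last _)
        - a * b * (A.submatrix (Fin.succ ∘ Fin.castSucc) (Fin.succ ∘ Fin.castSucc)).det := by
  have h_minor : (A + single 0 (Fin.last _) a).submatrix Fin.castSucc Fin.succ
      = A.submatrix Fin.castSucc Fin.succ + single 0 (Fin.last n) a := by
    ext i j
    simp [single_apply, Fin.ext_iff]
  have h_comm : Fin.castSucc ∘ Fin.succ = (Fin.succ ∘ Fin.castSucc : Fin n → Fin (n + 2)) := rfl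
  have h_sign : (-1 : R) ^ n * (-1) ^ n = 1 := by rw [← mul_pow, neg_one_mul, neg_neg, one_pow]
  rw [det_add_single, det_add_single, adjugate_fin_succ_eq_det_submatrix _ 0, Fin.succAbove_last,
    Fin.succAbove_zero, h_minor, det_add_single, adjugate_fin_succ_eq_det_submatrix _ (Fin.last n),
    adjugate_fin_succ_eq_det_submatrix _ 0 (Fin.last _), Fin.succAbove_last,
    Fin.succAbove_zero, submatrix_submatrix, h_comm]
  simp only [Fin.succAbove_last, Fin.succAbove_zero, Fin.val_zero, Fin.val_last, add_zero,
    zero_add, pow_succ]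
  linear_combination
    -(a * b * (A.submatrix (Fin.succ ∘ Fin.castSucc) (Fin.succ ∘ Fin.castSucc)).det) * h_sign

end Determinant

theorem cycleGraph_adj_iff_pathGraph_adj_or {n : ℕ} {i j : Fin (n + 2)} :
    (SimpleGraph.cycleGraph (n + 2)).Adj i j ↔ (SimpleGraph.pathGraph (n + 2)).Adj i j ∨
      (i = 0 ∧ j = Fin.last _) ∨ (i = Fin.last _ ∧ j = 0) := by
  have h_succ (i j : Fin (n + 2)) :
      i - j = 1 ↔ j.val + 1 = i.val ∨ (j = Fin.last _ ∧ i = 0) := by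
    rw [sub_eq_iff_eq_add', Fin.ext_iff, Fin.val_add_one]
    split_ifs with h
    all_goals simp only [Fin.ext_iff, Fin.val_last, Fin.val_zero] at h ⊢; omega
  rw [SimpleGraph.cycleGraph_adj, h_succ, h_succ, SimpleGraph.pathGraph_adj]
  tauto

theorem prod_apply_finRotate {M : Type*} [CommMonoid M] {n : ℕ}
    (F : Fin (n + 1) → Fin (n + 1) → M) :
    ∏ i, F i (finRotate (n + 1) i) = (∏ i : Fin n, F i.castSucc i.succ) * F (Fin.last n) 0 := by
  simp only [Fin.prod_univ_castSucc, finRotate_apply, Fin.coeSucc_eq_succ, Fin.last_add_one]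

theorem f_add_one (n : ℕ) : f (n + 1) = f n + X * f (n - 1) := by
  rw [f_rec _ (by omega), add_sub_cancel_right]
  congr 3
  ring

/-- The matrices `1 + itA`, `A` the Hermitian adjacency matrix of a gain graph on `G`, over an
arbitrary ring: unit diagonal, zero entries at non-adjacent pairs, and opposite entries on an edge
with product `-u`, where `u = t²`. -/
structure IsGainMatrix {V R : Type*} [CommRing R] (G : SimpleGraph V) (u : R)
    (M : Matrix V V R) : Prop where
  diag : ∀ v, M v v = 1
  mul_of_adj : ∀ v w, G.Adj v w → M v w * M w v = -u
  eq_zero : ∀ v w, v ≠ w → ¬ G.Adj v w → M v w = 0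

namespace IsGainMatrix

variable {R : Type*} [CommRing R] {u : R}

theorem submatrix {V W : Type*} {G : SimpleGraph V} {H : SimpleGraph W} {M : Matrix V V R}
    (hM : IsGainMatrix G u M) {c : W → V} (hc : Function.Injective c)
    (hadj : ∀ v w, H.Adj v w ↔ G.Adj (c v) (c w)) :
    IsGainMatrix H u (M.submatrix c c) where
  diag v := hM.diag (c v)
  mul_of_adj v w h := hM.mul_of_adj _ _ ((hadj v w).1 h)
  eq_zero v w hne h := hM.eq_zero _ _ (hc.ne hne) fun h' => h ((hadj v w).2 h')

theorem restrict_of_le {V : Type*} [DecidableEq V] {G H : SimpleGraph V} [DecidableRel H.Adj]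
    {M : Matrix V V R} (hM : IsGainMatrix G u M) (hle : H ≤ G) :
    IsGainMatrix H u (of fun v w => if v = w ∨ H.Adj v w then M v w else 0) where
  diag v := by simp [hM.diag]
  mul_of_adj v w h := by simp [h, h.symm, hM.mul_of_adj v w (hle h)]
  eq_zero v w hne h := by simp [hne, h]

theorem det_of_bridge {V W : Type*} [Fintype V] [Fintype W] [DecidableEq V] [DecidableEq W]
    {G : SimpleGraph (V ⊕ W)} {M : Matrix (V ⊕ W) (V ⊕ W) R} (hM : IsGainMatrix G u M)
    {v : V} {w : W} (h_bridge : ∀ v' w', G.Adj (.inl v') (.inr w') ↔ v' = v ∧ w' = w) :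
    M.det = (M.submatrix Sum.inl Sum.inl).det * (M.submatrix Sum.inr Sum.inr).det
      + u * (M.submatrix Sum.inl Sum.inl).adjugate v v
          * (M.submatrix Sum.inr Sum.inr).adjugate w w := by
  have h_blocks : M = fromBlocks (M.submatrix Sum.inl Sum.inl)
      (single v w (M (.inl v) (.inr w))) (single w v (M (.inr w) (.inl v)))
      (M.submatrix Sum.inr Sum.inr) := by
    ext (v' | w') (v'' | w'')
    · rfl
    · by_cases h : v' = v ∧ w'' = w
      · simp [h]
      · rw [hM.eq_zero _ _ (by simp) (by rwa [h_bridge]), fromBlocks_apply₁₂,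
          single_apply_of_ne _ _ _ _ _ fun h' => h ⟨h'.1.symm, h'.2.symm⟩]
    · by_cases h : v'' = v ∧ w' = w
      · simp [h]
      · rw [hM.eq_zero _ _ (by simp) (by rwa [G.adj_comm, h_bridge]), fromBlocks_apply₂₁,
          single_apply_of_ne _ _ _ _ _ fun h' => h ⟨h'.2.symm, h'.1.symm⟩]
    · rfl
  have h_edge := hM.mul_of_adj _ _ ((h_bridge v w).2 ⟨rfl, rfl⟩)
  conv_lhs => rw [h_blocks]
  rw [det_fromBlocks_single_single, h_edge]
  ring

section Path

variable {n : ℕ}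

theorem submatrix_castSucc_pathGraph {M : Matrix (Fin (n + 1)) (Fin (n + 1)) R}
    (hM : IsGainMatrix (SimpleGraph.pathGraph (n + 1)) u M) :
    IsGainMatrix (SimpleGraph.pathGraph n) u (M.submatrix Fin.castSucc Fin.castSucc) :=
  hM.submatrix (Fin.castSucc_injective n) fun v w => by simp [SimpleGraph.pathGraph_adj]

theorem submatrix_succ_pathGraph {M : Matrix (Fin (n + 1)) (Fin (n + 1)) R}
    (hM : IsGainMatrix (SimpleGraph.pathGraph (n + 1)) u M) :
    IsGainMatrix (SimpleGraph.pathGraph n) u (M.submatrix Fin.succ Fin.succ) :=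
  hM.submatrix (Fin.succ_injective n) fun v w => by
    simp only [SimpleGraph.pathGraph_adj, Fin.val_succ]
    omega

theorem adjugate_zero_last_pathGraph {M : Matrix (Fin (n + 1)) (Fin (n + 1)) R}
    (hM : IsGainMatrix (SimpleGraph.pathGraph (n + 1)) u M) :
    M.adjugate 0 (Fin.last n) = (-1) ^ n * ∏ i : Fin n, M i.castSucc i.succ :=
  adjugate_zero_last_of_upper_eq_zero fun i j hij =>
    hM.eq_zero i j (by rintro rfl; omega) (by rw [SimpleGraph.pathGraph_adj]; omega)

theorem adjugate_last_zero_pathGraph {M : Matrix (Fin (n + 1)) (Fin (n + 1)) R}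
    (hM : IsGainMatrix (SimpleGraph.pathGraph (n + 1)) u M) :
    M.adjugate (Fin.last n) 0 = (-1) ^ n * ∏ i : Fin n, M i.succ i.castSucc :=
  adjugate_last_zero_of_lower_eq_zero fun i j hij =>
    hM.eq_zero i j (by rintro rfl; omega) (by rw [SimpleGraph.pathGraph_adj]; omega)

variable [Algebra ℝ R]

theorem det_pathGraph : ∀ {n : ℕ} {M : Matrix (Fin n) (Fin n) R},
    IsGainMatrix (SimpleGraph.pathGraph n) u M → M.det = aeval u (f n)
  | 0, M, _ => by simp [f_zero]
  | 1, M, hM => by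
    have h := f_add_one 0
    simp only [Nat.cast_zero, zero_add, zero_sub, f_zero, f_neg_one, mul_zero, add_zero] at h
    rw [det_fin_one, hM.diag, Nat.cast_one, h, map_one]
  | n + 2, M, hM => by
    let e : Fin (n + 1) ⊕ Fin 1 ≃ Fin (n + 2) := finSumFinEquiv
    have h_split : IsGainMatrix ((SimpleGraph.pathGraph (n + 2)).comap e) u (M.submatrix e e) :=
      hM.submatrix e.injective fun _ _ => Iff.rfl
    have h_bridge (i : Fin (n + 1)) (j : Fin 1) :
        ((SimpleGraph.pathGraph (n + 2)).comap e).Adj (.inl i) (.inr j) ↔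
          i = Fin.last n ∧ j = 0 := by
      simp only [SimpleGraph.comap_adj, SimpleGraph.pathGraph_adj, Fin.ext_iff, Fin.val_last, e,
        finSumFinEquiv_apply_left, finSumFinEquiv_apply_right, Fin.val_castAdd, Fin.val_natAdd]
      omega
    have h_init : (M.submatrix e e).submatrix Sum.inl Sum.inl
      = M.submatrix Fin.castSucc Fin.castSucc := rfl
    have h_rec : f (n + 2 : ℕ) = f (n + 1) + X * f n := by
      have h := f_add_one (n + 1)
      push_cast at h ⊢
      rwa [add_sub_cancel_right, add_assoc, one_add_one_eq_two] at h
    rw [← det_submatrix_equiv_self e, h_split.det_of_bridge h_bridge, h_init,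
      adjugate_fin_succ_eq_det_submatrix, Fin.succAbove_last,
      det_pathGraph hM.submatrix_castSucc_pathGraph,
      det_pathGraph hM.submatrix_castSucc_pathGraph.submatrix_castSucc_pathGraph,
      adjugate_subsingleton, det_fin_one, h_rec]
    simp [hM.diag]

theorem adjugate_last_pathGraph {M : Matrix (Fin (n + 1)) (Fin (n + 1)) R}
    (hM : IsGainMatrix (SimpleGraph.pathGraph (n + 1)) u M) :
    M.adjugate (Fin.last n) (Fin.last n) = aeval u (f n) := by
  rw [adjugate_fin_succ_eq_det_submatrix, Fin.succAbove_last,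
    hM.submatrix_castSucc_pathGraph.det_pathGraph]
  simp

end Path

section Cycle

variable [Algebra ℝ R]

theorem adjugate_cycleGraph : ∀ {m : ℕ} {M : Matrix (Fin m) (Fin m) R},
    IsGainMatrix (SimpleGraph.cycleGraph m) u M → ∀ i, M.adjugate i i = aeval u (f (m - 1))
  | 0, _, _, i => i.elim0
  | 1, M, _, i => by simp [f_zero]
  | n + 2, M, hM, i => by
    have h_rotate : IsGainMatrix (SimpleGraph.cycleGraph (n + 2)) u
        (M.submatrix (Equiv.addLeft i) (Equiv.addLeft i)) :=
      hM.submatrix (Equiv.addLeft i).injective fun j k => by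
        simp only [SimpleGraph.cycleGraph_adj, Equiv.coe_addLeft, add_sub_add_left_eq_sub]
    have h_path := h_rotate.submatrix (H := SimpleGraph.pathGraph (n + 1))
      (Fin.succ_injective (n + 1)) fun j k => by
        rw [cycleGraph_adj_iff_pathGraph_adj_or, SimpleGraph.pathGraph_adj,
          SimpleGraph.pathGraph_adj]
        simp [Fin.succ_ne_zero]
    calc M.adjugate i i = (M.submatrix (Equiv.addLeft i) (Equiv.addLeft i)).adjugate 0 0 := by
          have h := adjugate_submatrix_equiv_self (Equiv.addLeft i) M
          simpa using (congr_fun₂ h 0 0).symm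
      _ = aeval u (f (n + 1 : ℕ)) := by
          rw [adjugate_fin_succ_eq_det_submatrix, Fin.succAbove_zero, h_path.det_pathGraph]
          simp
      _ = _ := by
          congr 2
          push_cast
          ring

theorem det_cycleGraph {m : ℕ} (hm : 3 ≤ m) {M : Matrix (Fin m) (Fin m) R}
    (hM : IsGainMatrix (SimpleGraph.cycleGraph m) u M) :
    M.det = aeval u (g m)
      + (-1) ^ (m + 1) * (∏ i, M i (finRotate m i) + ∏ i, M (finRotate m i) i) := by
  classical
  obtain ⟨n, rfl⟩ : ∃ n, m = n + 3 := ⟨m - 3, by omega⟩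
  let P := of fun i j => if i = j ∨ (SimpleGraph.pathGraph (n + 3)).Adj i j then M i j else 0
  have hP : IsGainMatrix (SimpleGraph.pathGraph (n + 3)) u P :=
    hM.restrict_of_le fun i j h => cycleGraph_adj_iff_pathGraph_adj_or.2 (.inl h)
  have h_corners : M = P + single 0 (Fin.last _) (M 0 (Fin.last _))
      + single (Fin.last _) 0 (M (Fin.last _) 0) := by
    ext i j
    have h_zero := hM.eq_zero i j
    rw [cycleGraph_adj_iff_pathGraph_adj_or, SimpleGraph.pathGraph_adj] at h_zero
    simp only [P, Matrix.add_apply, of_apply, single_apply, SimpleGraph.pathGraph_adj]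
    grind
  have h_edge (i : Fin (n + 2)) : P i.castSucc i.succ = M i.castSucc i.succ ∧
      P i.succ i.castSucc = M i.succ i.castSucc := by
    simp [P, SimpleGraph.pathGraph_adj]
  have h_inner := hP.submatrix_succ_pathGraph.submatrix_castSucc_pathGraph.det_pathGraph
  rw [submatrix_submatrix] at h_inner
  have h_mul : M 0 (Fin.last _) * M (Fin.last _) 0 = -u := hM.mul_of_adj _ _
    (cycleGraph_adj_iff_pathGraph_adj_or.2 (.inr (.inl ⟨rfl, rfl⟩)))
  rw [h_corners, det_add_single_add_single, ← h_corners, hP.det_pathGraph, h_inner, h_mul,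
    hP.adjugate_zero_last_pathGraph, hP.adjugate_last_zero_pathGraph, g, prod_apply_finRotate M,
    prod_apply_finRotate fun i j => M j i,
    show ((n + 3 : ℕ) : ℤ) - 2 = (n + 1 : ℕ) by push_cast; ring]
  simp only [h_edge, map_add, map_mul, aeval_X]
  ring

end Cycle

section Join

variable [Algebra ℝ R] {V W : Type*} [Fintype V] [Fintype W] [DecidableEq V] [DecidableEq W]

theorem det_of_pendant_path : ∀ {n : ℕ} {G : SimpleGraph (V ⊕ Fin n)}
    {M : Matrix (V ⊕ Fin n) (V ⊕ Fin n) R}, IsGainMatrix G u M → ∀ {v : V},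
    (∀ v' p, G.Adj (.inl v') (.inr p) ↔ v' = v ∧ p.val + 1 = n) →
    (∀ p q, G.Adj (.inr p) (.inr q) ↔ (SimpleGraph.pathGraph n).Adj p q) →
    M.det = aeval u (f n) * (M.submatrix Sum.inl Sum.inl).det
      + u * aeval u (f (n - 1)) * (M.submatrix Sum.inl Sum.inl).adjugate v v
  | 0, _, M, _, v, _, _ => by
    have h_det : (M.submatrix Sum.inl Sum.inl).det = M.det :=
      det_submatrix_equiv_self (Equiv.sumEmpty V (Fin 0)).symm M
    simp [f_zero, f_neg_one, h_det]
  | n + 1, G, M, hM, v, h_attach, h_path => by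
    have h_tail : IsGainMatrix (SimpleGraph.pathGraph (n + 1)) u (M.submatrix Sum.inr Sum.inr) :=
      hM.submatrix Sum.inr_injective fun p q => (h_path p q).symm
    have h_bridge (v' p) : G.Adj (.inl v') (.inr p) ↔ v' = v ∧ p = Fin.last n := by
      simp [h_attach, Fin.ext_iff]
    rw [hM.det_of_bridge h_bridge, h_tail.det_pathGraph, h_tail.adjugate_last_pathGraph,
      Nat.cast_succ, add_sub_cancel_right]
    ring

theorem det_of_connecting_path {n : ℕ} {G : SimpleGraph (V ⊕ W ⊕ Fin (n + 1))}
    {M : Matrix (V ⊕ W ⊕ Fin (n + 1)) (V ⊕ W ⊕ Fin (n + 1)) R} (hM : IsGainMatrix G u M)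
    {v : V} {w : W}
    (h_left : ∀ v' x, G.Adj (.inl v') (.inr x) ↔ v' = v ∧ x = .inr 0)
    (h_right : ∀ w' p, G.Adj (.inr (.inl w')) (.inr (.inr p)) ↔ w' = w ∧ p = Fin.last n)
    (h_path : ∀ p q, G.Adj (.inr (.inr p)) (.inr (.inr q)) ↔
      (SimpleGraph.pathGraph (n + 1)).Adj p q)
    {A : Matrix V V R} {B : Matrix W W R} (hA : M.submatrix Sum.inl Sum.inl = A)
    (hB : M.submatrix (Sum.inr ∘ Sum.inl) (Sum.inr ∘ Sum.inl) = B) :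
    M.det = aeval u (f (n + 1)) * A.det * B.det
      + u * aeval u (f n) * (A.adjugate v v * B.det + B.adjugate w w * A.det)
      + u ^ 2 * aeval u (f (n - 1)) * A.adjugate v v * B.adjugate w w := by
  let c : W ⊕ Fin n → W ⊕ Fin (n + 1) := Sum.map id Fin.succ
  have hc : Function.Injective c := Function.injective_id.sumMap (Fin.succ_injective n)
  have h_range : Set.range c = {.inr 0}ᶜ := by
    ext (w' | p) <;> simp [c, Fin.exists_succ_eq]
  have h_right_part : IsGainMatrix (G.comap Sum.inr) u (M.submatrix Sum.inr Sum.inr) :=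
    hM.submatrix Sum.inr_injective fun _ _ => Iff.rfl
  have h_deleted : IsGainMatrix ((G.comap Sum.inr).comap c) u
      ((M.submatrix Sum.inr Sum.inr).submatrix c c) :=
    h_right_part.submatrix hc fun _ _ => Iff.rfl
  have h_det := h_right_part.det_of_pendant_path (v := w) (by simp [h_right, Fin.ext_iff])
    (by simp [h_path])
  have h_det_deleted := h_deleted.det_of_pendant_path (v := w)
    (by simp [c, h_right, Fin.ext_iff]) (by simp [c, h_path, SimpleGraph.pathGraph_adj])
  have hB_deleted : ((M.submatrix Sum.inr Sum.inr).submatrix c c).submatrix Sum.inl Sum.inl = B :=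
    hB
  rw [submatrix_submatrix, hB, Nat.cast_succ, add_sub_cancel_right] at h_det
  rw [hB_deleted] at h_det_deleted
  rw [hM.det_of_bridge h_left, adjugate_self_eq_det_submatrix _ _ hc h_range, h_det,
    h_det_deleted, hA]
  ring

end Join

end IsGainMatrix

namespace UnitGain

section Shifted

variable {V : Type*} {G : SimpleGraph V} (Φ : UnitGain G)

theorem coe_cycleGain {m : ℕ} (c : Fin m → V) (hc : ∀ i, G.Adj (c i) (c (finRotate m i))) :
    (Φ.cycleGain c hc : ℂ) = ∏ i, (Φ.gain ⟨(c i, c (finRotate m i)), hc i⟩ : ℂ) :=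
  map_prod Circle.coeHom _ _

variable [DecidableEq V] (t : ℝ)

/-- The matrix `1 + itA`, with `A` the Hermitian adjacency matrix, whose determinant enters the
Coulson integral of the energy. -/
noncomputable def shifted : Matrix V V ℂ := 1 + (Complex.I * t) • Φ.adjMatrix

theorem shifted_apply_of_adj {v w : V} (h : G.Adj v w) :
    Φ.shifted t v w = Complex.I * t * Φ.gain ⟨(v, w), h⟩ := by
  simp [shifted, adjMatrix, h.ne, h]

theorem shifted_apply_of_adj_symm {v w : V} (h : G.Adj v w) :
    Φ.shifted t w v = Complex.I * t * (starRingEnd ℂ) (Φ.gain ⟨(v, w), h⟩ : ℂ) := by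
  rw [Φ.shifted_apply_of_adj t h.symm, ← Circle.coe_inv_eq_conj, ← Φ.gain_symm]
  rfl

theorem isGainMatrix_shifted : IsGainMatrix G ((t ^ 2 : ℝ) : ℂ) (Φ.shifted t) where
  diag v := by simp [shifted, adjMatrix]
  mul_of_adj v w h := by
    rw [Φ.shifted_apply_of_adj t h, Φ.shifted_apply_of_adj_symm t h, mul_mul_mul_comm,
      Complex.mul_conj, Circle.normSq_coe]
    push_cast
    linear_combination (t : ℂ) ^ 2 * Complex.I_sq
  eq_zero v w hne h := by simp [shifted, adjMatrix, hne, h]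

section ClosedWalk

variable {m : ℕ} (c : Fin m → V) (hc : ∀ i, G.Adj (c i) (c (finRotate m i)))

theorem prod_shifted_apply_finRotate :
    ∏ i, Φ.shifted t (c i) (c (finRotate m i))
      = (Complex.I * t) ^ m * (Φ.cycleGain c hc : ℂ) := by
  simp only [fun i => Φ.shifted_apply_of_adj t (hc i), coe_cycleGain, Finset.prod_mul_distrib,
    Finset.prod_const, Finset.card_univ, Fintype.card_fin, mul_pow]

theorem prod_shifted_finRotate_apply :
    ∏ i, Φ.shifted t (c (finRotate m i)) (c i)
      = (Complex.I * t) ^ m * (starRingEnd ℂ) (Φ.cycleGain c hc : ℂ) := by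
  simp only [fun i => Φ.shifted_apply_of_adj_symm t (hc i), coe_cycleGain,
    Finset.prod_mul_distrib, Finset.prod_const, Finset.card_univ, Fintype.card_fin, mul_pow,
    map_prod]

end ClosedWalk

theorem det_shifted_submatrix_of_odd_cycle {m : ℕ} (hm : 3 ≤ m) (hm_odd : Odd m) {c : Fin m → V}
    (hc_inj : Function.Injective c)
    (hc_adj : ∀ i j, (SimpleGraph.cycleGraph m).Adj i j ↔ G.Adj (c i) (c j)) :
    ((Φ.shifted t).submatrix c c).det = aeval ((t ^ 2 : ℝ) : ℂ) (g m)
      - 2 * Complex.I * ((delta m * (Φ.cycleGain c fun i =>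
          (hc_adj _ _).1 (cycleGraph_adj_finRotate hm i) : ℂ).re * t ^ m : ℝ) : ℂ) := by
  have h_I : Complex.I ^ m = -Complex.I * (delta m : ℂ) := by
    obtain ⟨k, rfl⟩ := hm_odd
    rw [delta, show (2 * k + 1 + 1) / 2 = k + 1 by omega, pow_succ, pow_mul, Complex.I_sq]
    push_cast
    ring
  rw [((Φ.isGainMatrix_shifted t).submatrix hc_inj hc_adj).det_cycleGraph hm]
  simp only [submatrix_apply]
  rw [Φ.prod_shifted_apply_finRotate t c fun i => (hc_adj _ _).1 (cycleGraph_adj_finRotate hm i),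
    Φ.prod_shifted_finRotate_apply t c fun i => (hc_adj _ _).1 (cycleGraph_adj_finRotate hm i),
    ← mul_add, Complex.add_conj, hm_odd.add_one.neg_one_pow, mul_pow, h_I]
  push_cast
  ring

end Shifted

end UnitGain

section Dumbbell

variable {r s ℓ : ℕ}

theorem aeval_ofReal (x : ℝ) (p : ℝ[X]) : aeval (x : ℂ) p = (p.eval x : ℝ) :=
  aeval_algebraMap_apply_eq_algebraMap_eval x p

theorem det_shifted_submatrix_left (hr : 3 ≤ r) (hr_odd : Odd r) (Φ : UnitGain (dumbbell r s ℓ))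
    (t : ℝ) :
    ((Φ.shifted t).submatrix Sum.inl Sum.inl).det
      = aeval ((t ^ 2 : ℝ) : ℂ) (g r) - 2 * Complex.I * (alpha hr Φ * t ^ r : ℝ) :=
  Φ.det_shifted_submatrix_of_odd_cycle t hr hr_odd Sum.inl_injective fun _ _ => Iff.rfl

theorem det_shifted_submatrix_right (hs : 3 ≤ s) (hs_odd : Odd s) (Φ : UnitGain (dumbbell r s ℓ))
    (t : ℝ) :
    ((Φ.shifted t).submatrix (Sum.inr ∘ Sum.inl) (Sum.inr ∘ Sum.inl)).det
      = aeval ((t ^ 2 : ℝ) : ℂ) (g s) - 2 * Complex.I * (beta hs Φ * t ^ s : ℝ) :=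
  Φ.det_shifted_submatrix_of_odd_cycle t hs hs_odd (Sum.inr_injective.comp Sum.inl_injective)
    fun _ _ => Iff.rfl

theorem adjugate_shifted_submatrix_left (Φ : UnitGain (dumbbell r s ℓ)) (t : ℝ) (i : Fin r) :
    ((Φ.shifted t).submatrix Sum.inl Sum.inl).adjugate i i
      = aeval ((t ^ 2 : ℝ) : ℂ) (f (r - 1)) :=
  ((Φ.isGainMatrix_shifted t).submatrix Sum.inl_injective
    fun _ _ => Iff.rfl).adjugate_cycleGraph i

theorem adjugate_shifted_submatrix_right (Φ : UnitGain (dumbbell r s ℓ)) (t : ℝ) (j : Fin s) :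
    ((Φ.shifted t).submatrix (Sum.inr ∘ Sum.inl) (Sum.inr ∘ Sum.inl)).adjugate j j
      = aeval ((t ^ 2 : ℝ) : ℂ) (f (s - 1)) :=
  ((Φ.isGainMatrix_shifted t).submatrix (Sum.inr_injective.comp Sum.inl_injective)
    fun _ _ => Iff.rfl).adjugate_cycleGraph j

theorem det_shifted_of_edge (hr : 3 ≤ r) (hs : 3 ≤ s) (hr_odd : Odd r) (hs_odd : Odd s)
    (Φ : UnitGain (dumbbell r s 1)) (t : ℝ) :
    (Φ.shifted t).det = (kerZ r s 1 t - alpha hr Φ * beta hs Φ * kerW r s 1 t : ℝ)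
      + (-(alpha hr Φ * kerX r s 1 t + beta hs Φ * kerY r s 1 t) : ℝ) * Complex.I := by
  let e : Fin r ⊕ Fin s ≃ Vertex r s 1 :=
    .sumCongr (.refl _) (Equiv.sumEmpty (Fin s) (Fin 0)).symm
  have h_gain : IsGainMatrix ((dumbbell r s 1).comap e) ((t ^ 2 : ℝ) : ℂ)
      ((Φ.shifted t).submatrix e e) :=
    (Φ.isGainMatrix_shifted t).submatrix e.injective fun _ _ => Iff.rfl
  have h_bridge (i : Fin r) (j : Fin s) : ((dumbbell r s 1).comap e).Adj (.inl i) (.inr j) ↔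
      i = ⟨0, by omega⟩ ∧ j = ⟨0, by omega⟩ := by
    simp [e, dumbbell, DumbbellAdj, Fin.ext_iff]
  have h_left : ((Φ.shifted t).submatrix e e).submatrix Sum.inl Sum.inl
      = (Φ.shifted t).submatrix Sum.inl Sum.inl := rfl
  have h_right : ((Φ.shifted t).submatrix e e).submatrix Sum.inr Sum.inr
      = (Φ.shifted t).submatrix (Sum.inr ∘ Sum.inl) (Sum.inr ∘ Sum.inl) := rfl
  have h_f : f ((1 : ℕ) - 1) = 1 ∧ f ((1 : ℕ) - 2) = 0 := ⟨rfl, rfl⟩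
  rw [← det_submatrix_equiv_self e, h_gain.det_of_bridge h_bridge, h_left, h_right,
    det_shifted_submatrix_left hr hr_odd, det_shifted_submatrix_right hs hs_odd,
    adjugate_shifted_submatrix_left, adjugate_shifted_submatrix_right]
  simp only [kerZ, kerW, kerX, kerY, polyR, polyS, polyM, polyT, if_true, h_f, aeval_ofReal,
    eval_add, eval_mul, eval_X, eval_one, eval_zero]
  push_cast
  linear_combination (4 * (alpha hr Φ : ℂ) * beta hs Φ * t ^ (r + s)) * Complex.I_sq

theorem det_shifted_of_path {n : ℕ} (hr : 3 ≤ r) (hs : 3 ≤ s) (hr_odd : Odd r) (hs_odd : Odd s)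
    (Φ : UnitGain (dumbbell r s (n + 2))) (t : ℝ) :
    (Φ.shifted t).det = (kerZ r s (n + 2) t - alpha hr Φ * beta hs Φ * kerW r s (n + 2) t : ℝ)
      + (-(alpha hr Φ * kerX r s (n + 2) t + beta hs Φ * kerY r s (n + 2) t) : ℝ)
        * Complex.I := by
  have h_left (i : Fin r) (x : Fin s ⊕ Fin (n + 1)) :
      (dumbbell r s (n + 2)).Adj (.inl i) (.inr x) ↔ i = ⟨0, by omega⟩ ∧ x = .inr 0 := by
    rcases x with j | p
    · simp [dumbbell, DumbbellAdj]
    · simp only [dumbbell, DumbbellAdj, Fin.ext_iff, Sum.inr.injEq, Fin.val_zero]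
  have h_right (j : Fin s) (p : Fin (n + 1)) :
      (dumbbell r s (n + 2)).Adj (.inr (.inl j)) (.inr (.inr p)) ↔
        j = ⟨0, by omega⟩ ∧ p = Fin.last n := by
    simp [dumbbell, DumbbellAdj, Fin.ext_iff]
  have h_index : ((n + 2 : ℕ) : ℤ) - 1 = n + 1 ∧ ((n + 2 : ℕ) : ℤ) - 2 = n ∧
      ((n + 2 : ℕ) : ℤ) - 3 = n - 1 := by
    omega
  rw [(Φ.isGainMatrix_shifted t).det_of_connecting_path h_left h_right (fun _ _ => Iff.rfl)
      rfl rfl,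
    det_shifted_submatrix_left hr hr_odd, det_shifted_submatrix_right hs hs_odd,
    adjugate_shifted_submatrix_left, adjugate_shifted_submatrix_right]
  simp only [kerZ, kerW, kerX, kerY, polyR, polyS, polyM, polyT, h_index,
    if_neg (show n + 2 ≠ 1 by omega), aeval_ofReal, eval_add, eval_mul, eval_pow, eval_X]
  push_cast
  linear_combination (4 * (alpha hr Φ : ℂ) * beta hs Φ * t ^ (r + s)
    * ((f (n + 1)).eval (t ^ 2) : ℝ)) * Complex.I_sq

theorem kernelK_eq_normSq_det_shifted (hr : 3 ≤ r) (hs : 3 ≤ s) (hℓ : 1 ≤ ℓ) (hr_odd : Odd r)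
    (hs_odd : Odd s) (Φ : UnitGain (dumbbell r s ℓ)) (t : ℝ) :
    kernelK r s ℓ (alpha hr Φ) (beta hs Φ) t = Complex.normSq (Φ.shifted t).det := by
  have h_det : (Φ.shifted t).det = (kerZ r s ℓ t - alpha hr Φ * beta hs Φ * kerW r s ℓ t : ℝ)
      + (-(alpha hr Φ * kerX r s ℓ t + beta hs Φ * kerY r s ℓ t) : ℝ) * Complex.I := by
    match ℓ, hℓ with
    | 1, _ => exact det_shifted_of_edge hr hs hr_odd hs_odd Φ t
    | n + 2, _ => exact det_shifted_of_path hr hs hr_odd hs_odd Φ t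
  rw [h_det, Complex.normSq_add_mul_I, kernelK, neg_sq]

end Dumbbell

section KernelPolynomials

theorem f_sq_sub_mul (n : ℕ) : f n ^ 2 - f (n + 1) * f (n - 1) = (-1) ^ n * X ^ n := by
  induction n with
  | zero => simp [f_zero, f_neg_one]
  | succ n ih =>
    have h_next := f_add_one (n + 1)
    have h := f_add_one n
    push_cast at h_next ⊢
    rw [add_sub_cancel_right] at h_next ⊢
    rw [h_next, pow_succ, pow_succ]
    linear_combination (-X) * ih + f (n + 1) * h

theorem polyR_mul_polyS_sub_polyM_mul_polyT (r s : ℕ) {ℓ : ℕ} (hℓ : 1 ≤ ℓ) :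
    polyR s ℓ * polyS r ℓ - polyM r s ℓ * polyT ℓ
      = (-1) ^ ℓ * X ^ ℓ * f (r - 1) * f (s - 1) := by
  match ℓ, hℓ with
  | 1, _ =>
    have h_f : f ((1 : ℕ) - 1) = 1 ∧ f ((1 : ℕ) - 2) = 0 := ⟨rfl, rfl⟩
    simp only [polyR, polyS, polyM, polyT, if_true, h_f]
    ring
  | n + 2, _ =>
    have h_index : ((n + 2 : ℕ) : ℤ) - 1 = n + 1 ∧ ((n + 2 : ℕ) : ℤ) - 2 = n ∧
        ((n + 2 : ℕ) : ℤ) - 3 = n - 1 := by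
      omega
    simp only [polyR, polyS, polyM, polyT, if_neg (show n + 2 ≠ 1 by omega), h_index, pow_add]
    linear_combination X ^ 2 * f (r - 1) * f (s - 1) * f_sq_sub_mul n

theorem eval_f_pos {x : ℝ} (hx : 0 ≤ x) (n : ℕ) : 0 < (f n).eval x := by
  suffices h : 0 ≤ (f (n - 1)).eval x ∧ 0 < (f n).eval x from h.2
  induction n with
  | zero => simp [f_zero, f_neg_one]
  | succ n ih =>
    push_cast
    rw [add_sub_cancel_right, f_add_one, eval_add, eval_mul, eval_X]
    exact ⟨ih.2.le, add_pos_of_pos_of_nonneg ih.2 (mul_nonneg hx ih.1)⟩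

theorem sign_kerX_mul_kerY_sub_kerZ_mul_kerW {r s ℓ : ℕ} (hr : 1 ≤ r) (hs : 1 ≤ s) (hℓ : 1 ≤ ℓ)
    {t : ℝ} (ht : 0 < t) :
    Real.sign (kerX r s ℓ t * kerY r s ℓ t - kerZ r s ℓ t * kerW r s ℓ t) = (-1) ^ ℓ := by
  have h_eval := congrArg (eval (t ^ 2)) (polyR_mul_polyS_sub_polyM_mul_polyT r s hℓ)
  simp only [eval_sub, eval_mul, eval_pow, eval_neg, eval_one, eval_X] at h_eval
  have hf_r := eval_f_pos (sq_nonneg t) (r - 1)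
  have hf_s := eval_f_pos (sq_nonneg t) (s - 1)
  push_cast [hr, hs] at hf_r hf_s
  have h_factor : kerX r s ℓ t * kerY r s ℓ t - kerZ r s ℓ t * kerW r s ℓ t
      = (-1) ^ ℓ * (4 * t ^ (r + s) * (t ^ 2) ^ ℓ *
        ((f (r - 1)).eval (t ^ 2) * (f (s - 1)).eval (t ^ 2))) := by
    simp only [kerX, kerY, kerZ, kerW, pow_add]
    linear_combination 4 * t ^ r * t ^ s * h_eval
  have h_pos : 0 < 4 * t ^ (r + s) * (t ^ 2) ^ ℓ *
      ((f (r - 1)).eval (t ^ 2) * (f (s - 1)).eval (t ^ 2)) := by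
    positivity
  rw [h_factor]
  rcases neg_one_pow_eq_or ℝ ℓ with h | h
  · rw [h, one_mul, Real.sign_of_pos h_pos]
  · rw [h, neg_one_mul, Real.sign_of_neg (neg_lt_zero.2 h_pos)]

end KernelPolynomials

end GainDumbbell

theorem mainTheorem4 (r s ℓ : ℕ) (hr : 3 ≤ r) (hs : 3 ≤ s) (hℓ : 1 ≤ ℓ)
    (hr_odd : Odd r) (hs_odd : Odd s) :
    (∀ Φ : GainDumbbell.UnitGain (GainDumbbell.dumbbell r s ℓ),
      (∀ t : ℝ, 0 < t →
        0 < GainDumbbell.kernelK r s ℓ (GainDumbbell.alpha hr Φ) (GainDumbbell.beta hs Φ) t) ∧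
      MeasureTheory.IntegrableOn
        (fun t : ℝ => 1 / t ^ 2 * Real.log
          (GainDumbbell.kernelK r s ℓ (GainDumbbell.alpha hr Φ) (GainDumbbell.beta hs Φ) t))
        (Set.Ioi 0) ∧
      Φ.energy = 1 / Real.pi * ∫ t in Set.Ioi (0 : ℝ), 1 / t ^ 2 * Real.log
        (GainDumbbell.kernelK r s ℓ (GainDumbbell.alpha hr Φ) (GainDumbbell.beta hs Φ) t)) ∧
    (GainDumbbell.polyR s ℓ * GainDumbbell.polyS r ℓ
        - GainDumbbell.polyM r s ℓ * GainDumbbell.polyT ℓ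
      = (-1) ^ ℓ * Polynomial.X ^ ℓ * GainDumbbell.f (r - 1) * GainDumbbell.f (s - 1)) ∧
    (∀ t : ℝ, 0 < t →
      Real.sign (GainDumbbell.kerX r s ℓ t * GainDumbbell.kerY r s ℓ t
        - GainDumbbell.kerZ r s ℓ t * GainDumbbell.kerW r s ℓ t) = (-1) ^ ℓ) := by
  refine ⟨fun Φ => ?_, GainDumbbell.polyR_mul_polyS_sub_polyM_mul_polyT r s hℓ, fun t ht =>
    GainDumbbell.sign_kerX_mul_kerY_sub_kerZ_mul_kerW (by omega) (by omega) hℓ ht⟩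
  have hA := Φ.adjMatrix_isHermitian
  simp only [GainDumbbell.kernelK_eq_normSq_det_shifted hr hs hℓ hr_odd hs_odd]
  exact ⟨fun t _ => GainDumbbell.normSq_det_one_add_I_mul_smul_pos hA t,
    GainDumbbell.integrableOn_log_normSq_det hA,
    GainDumbbell.sum_abs_eigenvalues_eq_integral hA⟩
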